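/- Let $d,q,N\ge 1$ be integers, let $x_1,\dots,x_N\in\mathbb R^d$, let $\mathcal S\ne\emptyset$ and $\mathcal I$ be sets of index pairs $(i,j)\in\{1,\dots,N\}^2$, let $\mu>0$, and let $\Lambda\in\mathbb R^{q\times q}$ be a diagonal matrix with positive diagonal entries. Write $A\bullet B=\operatorname{Tr}(A^\top B)$, $n=|\mathcal S|$, $X_{ij}=(x_i-x_j)(x_i-x_j)^\top$ and $\tilde X_{ij}=X_{ij}\otimes\Lambda\in\mathbb R^{qd\times qd}$. For $(u,v)\in\mathcal C=\{(u,v)\in\{1,\dots,q\}^2: u\le v\}$ let $A_{uv}$ be the block diagonal matrix with $d$ identical diagonal blocks $B_{uv}\in\mathbb R^{q\times q}$, where the $(u,v)$ and $(v,u)$ entries of $B_{uv}$ are $1$ and all others are $0$, and let $b_{uv}=1$ if $u=v$ and $b_{uv}=0$ otherwise. Consider the semidefinite program $$\min_{\tilde Q\succeq 0}\ \frac1n\sum_{(i,j)\in\mathcal S}\tilde X_{ij}\bullet\tilde Q\quad\text{s.t.}\quad \tilde X_{ij}\bullet\tilde Q\ge\mu\ \ \forall (i,j)\in\mathcal I,\qquad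 A_{uv}\bullet\tilde Q=b_{uv}\ \ \forall (u,v)\in\mathcal C,$$ over symmetric positive semidefinite $\tilde Q\in\mathbb R^{qd\times qd}$. **Theorem.** Let $\tilde Q^*$ be an optimal solution of this program, let $r=\operatorname{rank}\tilde Q^*$, and let $\xi$ be a random vector in $\mathbb R^{qd}$ with law $\mathcal N(0,\tilde Q^*)$. Put $\tilde G=\frac1n\sum_{(i,j)\in\mathcal S}\tilde X_{ij}$, $\nu=\min_{(i,j)\in\mathcal I}\xi^\top\tilde X_{ij}\xi$ (with $\nu=+\infty$ if $\mathcal I=\emptyset$) and $\zeta=\max_{(u,v)\in\mathcal C}|\xi^\top A_{uv}\xi-b_{uv}|$. Then for all $\gamma>0$, $\epsilon\ge0$ and $\omega\ge1$, with $\tau=\sqrt{\frac{\epsilon}{q}\sqrt{\frac{2}{rd}}+1}$, $$\Pr\big(\nu\ge\gamma\mu,\ \ \zeta\le\epsilon,\ \ \xi^\top\tilde G\xi\le\omega\,\tilde G\bullet\tilde Q^*\big)\ \ge\ 1-|\mathcal I|\max\Big(\sqrt\gamma,\frac{2(r-1)\gamma}{\pi-2}\Big)-r\exp\Big(-\tfrac12\big(\omega-\sqrt{2\omega-1}\big)\Big)-\frac{rq(q+1)}2\Big[\exp\Big(-\frac{(\tau-1)^2}4\Big)+\exp\Big(-\frac{\epsilon^2}{8rdq^2}\Big)\Big].$$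 -/

import Mathlib

noncomputable section

namespace PseudoBDML

open Matrix
open scoped Kronecker

variable {N d q : ℕ}

/-- The Frobenius inner product `A • B = Tr (Aᵀ B)`. -/
def frob {m : Type*} [Fintype m] (A B : Matrix m m ℝ) : ℝ := (Aᵀ * B).trace

/-- The quadratic form `ξᵀ A ξ`. -/
def quad {m : Type*} [Fintype m] (A : Matrix m m ℝ) (ξ : EuclideanSpace ℝ m) : ℝ :=
  ξ.ofLp ⬝ᵥ (A *ᵥ ξ.ofLp)

/-- `X_{ij} = (x_i - x_j) (x_i - x_j)ᵀ`, for the index pair `p = (i, j)`. -/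
def pairMatrix (x : Fin N → Fin d → ℝ) (p : Fin N × Fin N) : Matrix (Fin d) (Fin d) ℝ :=
  vecMulVec (x p.1 - x p.2) (x p.1 - x p.2)

/-- `X̃_{ij} = X_{ij} ⊗ Λ`, where `Λ = diag lam`. The `(k, u)`-th coordinate of a vector of `ℝ^{qd}`
stands for the entry in row `u` and column `k` of a `q × d` matrix (stacked columns). -/
def liftedPair (x : Fin N → Fin d → ℝ) (lam : Fin q → ℝ) (p : Fin N × Fin N) :
    Matrix (Fin d × Fin q) (Fin d × Fin q) ℝ :=
  pairMatrix x p ⊗ₖ diagonal lam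

/-- The averaged matrix `G̃ = (1 / |S|) ∑_{(i, j) ∈ S} X̃_{ij}`. -/
def objMatrix (x : Fin N → Fin d → ℝ) (lam : Fin q → ℝ) (S : Finset (Fin N × Fin N)) :
    Matrix (Fin d × Fin q) (Fin d × Fin q) ℝ :=
  (1 / (S.card : ℝ)) • ∑ p ∈ S, liftedPair x lam p

/-- The `q × q` matrix `B_{uv}`: its `(u, v)` and `(v, u)` entries are `1`, all others are `0`. -/
def orthBlock (u v : Fin q) : Matrix (Fin q) (Fin q) ℝ :=
  Matrix.of fun a b => if (a = u ∧ b = v) ∨ (a = v ∧ b = u) then 1 else 0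

/-- `A_{uv}`: the block diagonal matrix with `d` identical diagonal blocks `B_{uv}`. -/
def orthMatrix (d : ℕ) {q : ℕ} (u v : Fin q) : Matrix (Fin d × Fin q) (Fin d × Fin q) ℝ :=
  (1 : Matrix (Fin d) (Fin d) ℝ) ⊗ₖ orthBlock u v

/-- The right-hand side `b_{uv}` of the orthogonality constraints. -/
def orthRhs (u v : Fin q) : ℝ := if u = v then 1 else 0

/-- The index set `C = {(u, v) | u ≤ v}` of the orthogonality constraints. -/
def orthIndex (q : ℕ) : Finset (Fin q × Fin q) :=
  Finset.univ.filter fun p => p.1 ≤ p.2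

/-- The objective `(1 / |S|) ∑_{(i, j) ∈ S} X̃_{ij} • Q̃` of the semidefinite relaxation. -/
def sdpObjective (x : Fin N → Fin d → ℝ) (lam : Fin q → ℝ) (S : Finset (Fin N × Fin N))
    (Q : Matrix (Fin d × Fin q) (Fin d × Fin q) ℝ) : ℝ :=
  (1 / (S.card : ℝ)) * ∑ p ∈ S, frob (liftedPair x lam p) Q

/-- Feasibility for the semidefinite relaxation. -/
structure IsFeasible (x : Fin N → Fin d → ℝ) (lam : Fin q → ℝ) (μ : ℝ)
    (I : Finset (Fin N × Fin N)) (Q : Matrix (Fin d × Fin q) (Fin d × Fin q) ℝ) : Prop where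
  posSemidef : Q.PosSemidef
  margin : ∀ p ∈ I, μ ≤ frob (liftedPair x lam p) Q
  orth : ∀ p ∈ orthIndex q, frob (orthMatrix d p.1 p.2) Q = orthRhs p.1 p.2

/-- `Q` is an optimal solution of the semidefinite relaxation. -/
structure IsOptimal (x : Fin N → Fin d → ℝ) (lam : Fin q → ℝ) (μ : ℝ)
    (S I : Finset (Fin N × Fin N)) (Q : Matrix (Fin d × Fin q) (Fin d × Fin q) ℝ) : Prop where
  feasible : IsFeasible x lam μ I Q
  le_of_feasible : ∀ Q', IsFeasible x lam μ I Q' →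
    sdpObjective x lam S Q ≤ sdpObjective x lam S Q'

/-- `ν = min_{(i, j) ∈ I} ξᵀ X̃_{ij} ξ`, with value `+∞` when `I` is empty. -/
def minMargin (x : Fin N → Fin d → ℝ) (lam : Fin q → ℝ) (I : Finset (Fin N × Fin N))
    (ξ : EuclideanSpace ℝ (Fin d × Fin q)) : EReal :=
  I.inf fun p => ((quad (liftedPair x lam p) ξ : ℝ) : EReal)

/-- `ζ = max_{(u, v) ∈ C} |ξᵀ A_{uv} ξ - b_{uv}|`. -/
def maxOrthError (ξ : EuclideanSpace ℝ (Fin d × Fin q)) : EReal :=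
  (orthIndex q).sup fun p =>
    ((|quad (orthMatrix d p.1 p.2) ξ - orthRhs p.1 p.2| : ℝ) : EReal)

end PseudoBDML

end

/-! ### One standard Gaussian variable: small balls and tails. -/

namespace PseudoBDML

open MeasureTheory ProbabilityTheory
open scoped ENNReal NNReal

/-! Write `ξ = B g` with `B = √Q` and `g` standard Gaussian. Then `ξᵀAξ = gᵀ(BAB)g`, and in an
eigenbasis of `BAB` this is a weighted sum `∑ lᵢ gᵢ²` with at most `rank Q` nonzero weights and
total weight `A • Q` (`exists_diagonalization`). Each of the three failure events thus reduces to an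
event about a few independent scalar Gaussians, and a union bound finishes.

Margins: either one weight carries a fraction `2/π` of the total, and a single small-ball bound
gives `√γ`, or two weights are substantial, and independence multiplies two such bounds into a term
linear in `γ`. Objective: if the sum exceeds `ω` times its mean, some active `gᵢ²` exceeds `ω`.
Orthogonality: `A_{uv}` has norm at most one and `tr Q = q`, so `∑ |lᵢ| ≤ q`, and an error above
`qδ` forces some active `|gᵢ² - 1| > δ`. The scalar estimates obtained are stronger than the
exponentials in the theorem, which follow by monotonicity. -/

theorem gaussianPDFReal_std_le (x : ℝ) : gaussianPDFReal 0 1 x ≤ (√(2 * Real.pi))⁻¹ := by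
  rw [gaussianPDFReal]
  simp only [NNReal.coe_one, mul_one, sub_zero]
  refine mul_le_of_le_one_right (by positivity) (Real.exp_le_one_iff.2 ?_)
  have := sq_nonneg x
  linarith

/-- Small-ball estimate for a standard Gaussian variable. -/
theorem gaussianReal_sq_lt_le (s : ℝ) :
    (gaussianReal 0 1).real {x | x ^ 2 < s} ≤ √(2 / Real.pi) * √s := by
  have hset : {x : ℝ | x ^ 2 < s} = Set.Ioo (-√s) (√s) := by
    ext x
    simp [Real.sq_lt]
  have hle : gaussianReal 0 1 {x : ℝ | x ^ 2 < s}
      ≤ ENNReal.ofReal (√(2 / Real.pi) * √s) := by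
    rw [hset, gaussianReal_apply 0 one_ne_zero]
    calc ∫⁻ x in Set.Ioo (-√s) (√s), gaussianPDF 0 1 x
        ≤ ∫⁻ _ in Set.Ioo (-√s) (√s), ENNReal.ofReal (√(2 * Real.pi))⁻¹ :=
          lintegral_mono fun x => ENNReal.ofReal_le_ofReal (gaussianPDFReal_std_le x)
      _ = ENNReal.ofReal ((√(2 * Real.pi))⁻¹ * (√s - -√s)) := by
          rw [setLIntegral_const, Real.volume_Ioo, ENNReal.ofReal_mul (by positivity)]
      _ ≤ ENNReal.ofReal (√(2 / Real.pi) * √s) := by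
          refine ENNReal.ofReal_le_ofReal (le_of_eq ?_)
          have h2 : √(2 : ℝ) * √2 = 2 := Real.mul_self_sqrt (by norm_num)
          have hp : 0 < √Real.pi := Real.sqrt_pos.2 Real.pi_pos
          rw [Real.sqrt_mul (by norm_num), Real.sqrt_div (by norm_num)]
          field_simp
          linear_combination (-√s) * h2
  exact ENNReal.toReal_le_of_le_ofReal (by positivity) hle

/-- The ratio of the two densities is `exp (m y - m² / 2)`, and the cross term has a favourable
sign. -/
theorem gaussianPDF_shift_le (m y : ℝ) (h : m * y ≤ 0) :
    gaussianPDF m 1 y ≤ ENNReal.ofReal (Real.exp (-(m ^ 2 / 2))) * gaussianPDF 0 1 y := by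
  rw [gaussianPDF, gaussianPDF, ← ENNReal.ofReal_mul (by positivity)]
  refine ENNReal.ofReal_le_ofReal ?_
  rw [gaussianPDFReal, gaussianPDFReal, mul_left_comm, ← Real.exp_add]
  gcongr
  simp only [NNReal.coe_one, mul_one]
  nlinarith

theorem gaussianReal_shift_le (m : ℝ) (s : Set ℝ) (hs : MeasurableSet s)
    (h : ∀ y ∈ s, m * y ≤ 0) :
    gaussianReal m 1 s ≤ ENNReal.ofReal (Real.exp (-(m ^ 2 / 2))) * gaussianReal 0 1 s := by
  rw [gaussianReal_apply _ one_ne_zero, gaussianReal_apply _ one_ne_zero,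
    ← lintegral_const_mul _ (by fun_prop)]
  exact setLIntegral_mono' hs fun y hy => gaussianPDF_shift_le m y (h y hy)

/-- Tail estimate for the square of a standard Gaussian variable. -/
theorem gaussianReal_lt_sq_le {t : ℝ} (ht : 0 ≤ t) :
    (gaussianReal 0 1).real {x | t < x ^ 2} ≤ Real.exp (-(t / 2)) := by
  have hset : {x : ℝ | t < x ^ 2} = Set.Ioi √t ∪ Set.Iio (-√t) := by
    ext x
    have h : t < x ^ 2 ↔ √t < |x| := by
      rw [← Real.sqrt_sq_eq_abs, Real.sqrt_lt_sqrt_iff ht]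
    exact h.trans (lt_abs.trans (or_congr Iff.rfl lt_neg))
  -- Translating the tail to a half-line at the origin turns the law into `N(-√t, 1)`, to which the
  -- density comparison applies.
  have hpos : gaussianReal 0 1 (Set.Ioi √t)
      ≤ ENNReal.ofReal (Real.exp (-(t / 2))) * gaussianReal 0 1 (Set.Ioi 0) := by
    have hmap : gaussianReal 0 1 = (gaussianReal (-√t) 1).map (· + √t) := by
      rw [gaussianReal_map_add_const]; simp
    have hpre : (fun x => x + √t) ⁻¹' Set.Ioi √t = Set.Ioi 0 := by ext; simp
    have := gaussianReal_shift_le (-√t) (Set.Ioi 0) measurableSet_Ioi fun y hy => by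
      have : 0 < y := hy
      nlinarith [Real.sqrt_nonneg t]
    rw [neg_sq, Real.sq_sqrt ht] at this
    refine le_trans (le_of_eq ?_) this
    conv_lhs => rw [hmap]
    rw [Measure.map_apply (by fun_prop) measurableSet_Ioi, hpre]
  have hneg : gaussianReal 0 1 (Set.Iio (-√t))
      ≤ ENNReal.ofReal (Real.exp (-(t / 2))) * gaussianReal 0 1 (Set.Iio 0) := by
    have hmap : gaussianReal 0 1 = (gaussianReal (√t) 1).map (· + -√t) := by
      rw [gaussianReal_map_add_const]; simp
    have hpre : (fun x => x + -√t) ⁻¹' Set.Iio (-√t) = Set.Iio 0 := by ext; simp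
    have := gaussianReal_shift_le (√t) (Set.Iio 0) measurableSet_Iio fun y hy => by
      have : y < 0 := hy
      nlinarith [Real.sqrt_nonneg t]
    rw [Real.sq_sqrt ht] at this
    refine le_trans (le_of_eq ?_) this
    conv_lhs => rw [hmap]
    rw [Measure.map_apply (by fun_prop) measurableSet_Iio, hpre]
  have hle : gaussianReal 0 1 {x : ℝ | t < x ^ 2} ≤ ENNReal.ofReal (Real.exp (-(t / 2))) := by
    -- The two half-lines are disjoint, so their masses total at most one; the two-sided tail
    -- therefore carries no factor 2.
    rw [hset]
    calc gaussianReal 0 1 (Set.Ioi √t ∪ Set.Iio (-√t))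
        ≤ _ := measure_union_le _ _
      _ ≤ _ := add_le_add hpos hneg
      _ = ENNReal.ofReal (Real.exp (-(t / 2))) * gaussianReal 0 1 (Set.Ioi 0 ∪ Set.Iio 0) := by
          rw [← mul_add, measure_union _ measurableSet_Iio]
          exact Set.disjoint_left.2 fun x (hx : 0 < x) (hx' : x < 0) => lt_asymm hx hx'
      _ ≤ ENNReal.ofReal (Real.exp (-(t / 2))) * 1 := by gcongr; exact prob_le_one
      _ = _ := mul_one _
  exact ENNReal.toReal_le_of_le_ofReal (by positivity) hle

/-- Concentration of the square of a standard Gaussian variable around its mean. -/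
theorem gaussianReal_lt_abs_sq_sub_one_le {δ : ℝ} (hδ : 0 ≤ δ) :
    (gaussianReal 0 1).real {x | δ < |x ^ 2 - 1|}
      ≤ Real.exp (-((1 + δ) / 2)) + Real.exp (-(δ ^ 2 / 4)) := by
  have hsub : {x : ℝ | δ < |x ^ 2 - 1|} ⊆ {x | 1 + δ < x ^ 2} ∪ {x | x ^ 2 < 1 - δ} := by
    intro x hx
    rcases lt_abs.1 (show δ < |x ^ 2 - 1| from hx) with h | h
    · exact Or.inl (show 1 + δ < x ^ 2 by linarith)
    · exact Or.inr (show x ^ 2 < 1 - δ by linarith)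
  refine (measureReal_mono hsub).trans ((measureReal_union_le _ _).trans
    (add_le_add (gaussianReal_lt_sq_le (by linarith)) ?_))
  refine (gaussianReal_sq_lt_le _).trans ?_
  have h2 : √(2 / Real.pi) ≤ 1 :=
    Real.sqrt_le_one.2 ((div_le_one Real.pi_pos).2 (by linarith [Real.pi_gt_three]))
  -- For `δ ≤ 1`, squaring reduces the claim to `1 - δ ≤ 1 - δ² / 2 ≤ exp (-δ² / 2)`. For `δ ≥ 1`
  -- the real square root of `1 - δ` is zero by convention.
  rcases le_total δ 1 with h1 | h1
  · refine (mul_le_of_le_one_left (Real.sqrt_nonneg _) h2).trans ?_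
    refine Real.sqrt_le_iff.2 ⟨by positivity, ?_⟩
    rw [← Real.exp_nat_mul]
    refine le_trans ?_ (Real.add_one_le_exp _)
    push_cast
    nlinarith
  · rw [Real.sqrt_eq_zero_of_nonpos (x := 1 - δ) (by linarith), mul_zero]
    positivity

/-! ### Weighted sums of independent squared Gaussians. -/

section Weighted

variable {ι : Type*} [Fintype ι]

/-- The law of a vector of independent standard Gaussian variables. -/
noncomputable abbrev stdPi (ι : Type*) [Fintype ι] : Measure (ι → ℝ) :=
  Measure.pi fun _ : ι => gaussianReal 0 1

theorem stdPi_real_eval (i : ι) {s : Set ℝ} (hs : MeasurableSet s) :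
    (stdPi ι).real {g | g i ∈ s} = (gaussianReal 0 1).real s :=
  (measurePreserving_eval (fun _ : ι => gaussianReal 0 1) i).measureReal_preimage hs.nullMeasurableSet

theorem stdPi_real_eval_inter {i j : ι} (hij : i ≠ j) {s t : Set ℝ} (hs : MeasurableSet s)
    (ht : MeasurableSet t) :
    (stdPi ι).real {g | g i ∈ s ∧ g j ∈ t}
      = (gaussianReal 0 1).real s * (gaussianReal 0 1).real t := by
  have hind := (iIndepFun_pi (μ := fun _ : ι => gaussianReal 0 1) (X := fun _ => id)
    fun _ => aemeasurable_id).indepFun hij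
  have := hind.measure_inter_preimage_eq_mul s t hs ht
  rw [← stdPi_real_eval i hs, ← stdPi_real_eval j ht, measureReal_def, measureReal_def,
    measureReal_def, ← ENNReal.toReal_mul]
  exact congrArg ENNReal.toReal this

/-- Small-ball estimate for a nonnegative combination of at most `r` independent squared standard
Gaussian variables. -/
theorem stdPi_sum_mul_sq_lt_le {l : ι → ℝ} (hl : ∀ i, 0 ≤ l i) {r : ℕ}
    (hr : (Finset.univ.filter fun i => l i ≠ 0).card ≤ r) (hpos : 0 < ∑ i, l i)
    {γ : ℝ} (hγ : 0 < γ) :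
    (stdPi ι).real {g | ∑ i, l i * g i ^ 2 < γ * ∑ i, l i}
      ≤ max √γ (2 * ((r : ℝ) - 1) * γ / (Real.pi - 2)) := by
  classical
  set m := ∑ i, l i with hm
  have hpi := Real.pi_pos
  have hpi3 := Real.pi_gt_three
  have hterm : ∀ (g : ι → ℝ) i, l i * g i ^ 2 ≤ ∑ i, l i * g i ^ 2 := fun g i =>
    Finset.single_le_sum (f := fun i => l i * g i ^ 2)
      (fun i _ => mul_nonneg (hl i) (sq_nonneg _)) (Finset.mem_univ i)
  have hmeas : ∀ a : ℝ, MeasurableSet {x : ℝ | x ^ 2 < a} := fun a =>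
    measurableSet_lt (by fun_prop) (by fun_prop)
  have hne : (Finset.univ : Finset ι).Nonempty := by
    rw [Finset.nonempty_iff_ne_empty]
    intro h
    simp [hm, h] at hpos
  obtain ⟨i, -, hi⟩ := Finset.exists_max_image Finset.univ l hne
  have hi0 : 0 < l i := by
    by_contra! h
    exact absurd hpos (not_lt.2 (Finset.sum_nonpos fun j hj => (hi j hj).trans h))
  -- The threshold `2/π` is tuned so that the one-coordinate bound `√(2/π) √(γπ/2)` is exactly `√γ`.
  rcases le_or_gt (2 / Real.pi * m) (l i) with hbig | hsmall
  · refine le_trans ?_ (le_max_left _ _)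
    have hsub : {g : ι → ℝ | ∑ i, l i * g i ^ 2 < γ * m}
        ⊆ {g | g i ∈ {x : ℝ | x ^ 2 < γ * Real.pi / 2}} := by
      intro g hg
      have h1 : l i * g i ^ 2 < γ * m := (hterm g i).trans_lt hg
      have h2 : 2 / Real.pi * m * g i ^ 2 < γ * m :=
        (mul_le_mul_of_nonneg_right hbig (sq_nonneg _)).trans_lt h1
      have h3 : 2 / Real.pi * g i ^ 2 < γ := by
        refine lt_of_mul_lt_mul_right (a := m) ?_ hpos.le
        linarith
      show g i ^ 2 < γ * Real.pi / 2
      rw [div_mul_eq_mul_div, div_lt_iff₀ hpi] at h3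
      linarith
    refine (measureReal_mono hsub).trans ?_
    rw [stdPi_real_eval i (hmeas _)]
    refine (gaussianReal_sq_lt_le _).trans (le_of_eq ?_)
    rw [← Real.sqrt_mul (by positivity)]
    congr 1
    field_simp
  · refine le_trans ?_ (le_max_right _ _)
    set T := (Finset.univ.filter fun j => l j ≠ 0).erase i with hT
    have hTcard : (T.card : ℝ) ≤ r - 1 := by
      have hmem : i ∈ Finset.univ.filter fun j => l j ≠ 0 := by simp [hi0.ne']
      have := Finset.card_erase_add_one hmem
      rw [← hT] at this
      have h' : T.card + 1 ≤ r := by omega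
      have : ((T.card + 1 : ℕ) : ℝ) ≤ r := by exact_mod_cast h'
      push_cast at this
      linarith
    have hsum : l i + ∑ j ∈ T, l j = m := by
      rw [hm, hT, Finset.add_sum_erase _ _ (by simp [hi0.ne']), Finset.sum_filter_ne_zero]
    have hpart : (1 - 2 / Real.pi) * m < ∑ j ∈ T, l j := by linarith
    have h2pi : 0 < 1 - 2 / Real.pi := by
      rw [sub_pos, div_lt_one hpi]; linarith
    -- Pigeonhole: apart from `i`, at most `r - 1` nonzero weights share a mass above `(1 - 2/π) m`,
    -- so the largest of them is at least the average.
    obtain ⟨j, hjT, hj⟩ : ∃ j ∈ T, (1 - 2 / Real.pi) * m ≤ (r - 1) * l j := by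
      have hTne : T.Nonempty := by
        rw [Finset.nonempty_iff_ne_empty]
        intro h
        rw [h, Finset.sum_empty] at hpart
        exact absurd hpart (not_lt.2 (by positivity))
      obtain ⟨j, hjT, hj⟩ := Finset.exists_max_image T l hTne
      refine ⟨j, hjT, hpart.le.trans ((Finset.sum_le_card_nsmul T l (l j) hj).trans ?_)⟩
      rw [nsmul_eq_mul]
      exact mul_le_mul_of_nonneg_right hTcard (hl j)
    have hji : i ≠ j := (Finset.ne_of_mem_erase hjT).symm
    have hj0 : 0 < l j := lt_of_le_of_ne (hl j) (Ne.symm (by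
      have := Finset.mem_of_mem_erase hjT
      simpa using this))
    have hr1 : 0 < (r : ℝ) - 1 :=
      pos_of_mul_pos_left ((mul_pos h2pi hpos).trans_le hj) hj0.le
    -- Since `l j ≤ l i`, the same bound `γ m / l j` constrains both squares.
    have hsub : {g : ι → ℝ | ∑ i, l i * g i ^ 2 < γ * m}
        ⊆ {g | g i ∈ {x : ℝ | x ^ 2 < γ * m / l j} ∧ g j ∈ {x : ℝ | x ^ 2 < γ * m / l j}} := by
      intro g hg
      have hg' : ∑ i, l i * g i ^ 2 < γ * m := hg
      refine ⟨?_, ?_⟩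
      · show g i ^ 2 < γ * m / l j
        rw [lt_div_iff₀ hj0]
        have := mul_le_mul_of_nonneg_left (hi j (Finset.mem_univ j)) (sq_nonneg (g i))
        linarith [hterm g i]
      · show g j ^ 2 < γ * m / l j
        rw [lt_div_iff₀ hj0]
        linarith [hterm g j]
    refine (measureReal_mono hsub).trans ?_
    rw [stdPi_real_eval_inter hji (hmeas _) (hmeas _)]
    have ha : 0 ≤ γ * m / l j := by positivity
    calc (gaussianReal 0 1).real {x : ℝ | x ^ 2 < γ * m / l j}
          * (gaussianReal 0 1).real {x : ℝ | x ^ 2 < γ * m / l j}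
        ≤ (√(2 / Real.pi) * √(γ * m / l j)) * (√(2 / Real.pi) * √(γ * m / l j)) :=
          mul_le_mul (gaussianReal_sq_lt_le _) (gaussianReal_sq_lt_le _) measureReal_nonneg
            (by positivity)
      _ = 2 / Real.pi * (γ * m / l j) := by
          rw [mul_mul_mul_comm, Real.mul_self_sqrt (by positivity), Real.mul_self_sqrt ha]
      _ ≤ 2 * ((r : ℝ) - 1) * γ / (Real.pi - 2) := by
          rw [div_mul_div_comm, div_le_div_iff₀ (by positivity) (by linarith)]
          have h1 : (Real.pi - 2) * m ≤ Real.pi * ((r - 1) * l j) := by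
            have := mul_le_mul_of_nonneg_left hj hpi.le
            rwa [← mul_assoc, mul_sub, mul_one, mul_div_cancel₀ _ hpi.ne'] at this
          nlinarith [mul_le_mul_of_nonneg_left h1 hγ.le]

/-- Union bound over at most `r` coordinates of a vector of independent standard Gaussian
variables. -/
theorem stdPi_real_exists_le (T : Finset ι) {s : Set ℝ} (hs : MeasurableSet s) {r : ℕ}
    (hr : T.card ≤ r) {b : ℝ} (hb : (gaussianReal 0 1).real s ≤ b) :
    (stdPi ι).real {g | ∃ i ∈ T, g i ∈ s} ≤ r * b := by
  have hset : {g : ι → ℝ | ∃ i ∈ T, g i ∈ s} = ⋃ i ∈ T, {g | g i ∈ s} := by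
    ext g; simp
  have hb0 : 0 ≤ b := measureReal_nonneg.trans hb
  rw [hset]
  calc (stdPi ι).real (⋃ i ∈ T, {g | g i ∈ s})
      ≤ ∑ i ∈ T, (stdPi ι).real {g | g i ∈ s} := measureReal_biUnion_finset_le _ _
    _ ≤ ∑ _i ∈ T, b := Finset.sum_le_sum fun i _ => by rwa [stdPi_real_eval i hs]
    _ = T.card * b := by rw [Finset.sum_const, nsmul_eq_mul]
    _ ≤ r * b := by gcongr

/-- Upper tail of a nonnegative combination of at most `r` squared standard Gaussian variables. -/
theorem stdPi_lt_sum_mul_sq_le {l : ι → ℝ} (hl : ∀ i, 0 ≤ l i) {r : ℕ}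
    (hr : (Finset.univ.filter fun i => l i ≠ 0).card ≤ r) {ω : ℝ} (hω : 0 ≤ ω) :
    (stdPi ι).real {g | ω * ∑ i, l i < ∑ i, l i * g i ^ 2} ≤ r * Real.exp (-(ω / 2)) := by
  refine (measureReal_mono ?_).trans (stdPi_real_exists_le (Finset.univ.filter fun i => l i ≠ 0)
    (s := {x | ω < x ^ 2}) (measurableSet_lt (by fun_prop) (by fun_prop)) hr
    (gaussianReal_lt_sq_le hω))
  -- If every active `g i ^ 2` were at most `ω`, summing with nonnegative weights would contradict
  -- the event.
  intro g hg
  by_contra hcon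
  refine absurd (show ω * ∑ i, l i < ∑ i, l i * g i ^ 2 from hg) (not_lt.2 ?_)
  rw [Finset.mul_sum]
  refine Finset.sum_le_sum fun i _ => ?_
  by_cases h0 : l i = 0
  · simp [h0]
  · have : g i ^ 2 ≤ ω := not_lt.1 fun h => hcon ⟨i, by simp [h0], h⟩
    rw [mul_comm ω]
    exact mul_le_mul_of_nonneg_left this (hl i)

/-- Two-sided concentration of a combination of at most `r` squared standard Gaussian variables. -/
theorem stdPi_lt_abs_sum_mul_sq_sub_le {l : ι → ℝ} {r : ℕ}
    (hr : (Finset.univ.filter fun i => l i ≠ 0).card ≤ r) {δ : ℝ} (hδ : 0 ≤ δ) :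
    (stdPi ι).real {g | (∑ i, |l i|) * δ < |∑ i, l i * g i ^ 2 - ∑ i, l i|}
      ≤ r * (Real.exp (-((1 + δ) / 2)) + Real.exp (-(δ ^ 2 / 4))) := by
  refine (measureReal_mono ?_).trans (stdPi_real_exists_le (Finset.univ.filter fun i => l i ≠ 0)
    (s := {x | δ < |x ^ 2 - 1|}) (measurableSet_lt (by fun_prop) (by fun_prop)) hr
    (gaussianReal_lt_abs_sq_sub_one_le hδ))
  intro g hg
  by_contra hcon
  refine absurd (show (∑ i, |l i|) * δ < |∑ i, l i * g i ^ 2 - ∑ i, l i| from hg) (not_lt.2 ?_)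
  rw [← Finset.sum_sub_distrib, Finset.sum_mul]
  refine (Finset.abs_sum_le_sum_abs _ _).trans (Finset.sum_le_sum fun i _ => ?_)
  by_cases h0 : l i = 0
  · simp [h0]
  · have : |g i ^ 2 - 1| ≤ δ := not_lt.1 fun h => hcon ⟨i, by simp [h0], h⟩
    rw [← mul_sub_one, abs_mul]
    exact mul_le_mul_of_nonneg_left this (abs_nonneg _)

end Weighted

end PseudoBDML

/-! ### Diagonalization of Gaussian quadratic forms. -/

namespace PseudoBDML

open MeasureTheory ProbabilityTheory Matrix
open scoped ENNReal NNReal MatrixOrder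

section Diagonalization

variable {ι : Type*} [Fintype ι]

theorem measurable_quad (A : Matrix ι ι ℝ) : Measurable (quad A) := by
  unfold quad dotProduct mulVec dotProduct
  fun_prop

variable [DecidableEq ι]

/-- A quadratic form in a centred Gaussian vector is distributed as a combination of independent
squared standard Gaussian variables. -/
theorem exists_diagonalization {A Q : Matrix ι ι ℝ} (hA : A.IsHermitian) (hQ : Q.PosSemidef) :
    ∃ l : ι → ℝ, (Finset.univ.filter fun i => l i ≠ 0).card ≤ Q.rank ∧ ∑ i, l i = frob A Q ∧
      ((∀ x, 0 ≤ quad A x) → ∀ i, 0 ≤ l i) ∧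
      ((∀ x : EuclideanSpace ℝ ι, |quad A x| ≤ x.ofLp ⬝ᵥ x.ofLp) → ∑ i, |l i| ≤ Q.trace) ∧
      ∀ s : Set ℝ, MeasurableSet s → (multivariateGaussian 0 Q).real {x | quad A x ∈ s}
        = (stdPi ι).real {g | ∑ i, l i * g i ^ 2 ∈ s} := by
  set B := CFC.sqrt Q with hB
  have hBB : B * B = Q := CFC.sqrt_mul_sqrt_self _ hQ.nonneg
  have hBps : B.PosSemidef := Matrix.nonneg_iff_posSemidef.1 (CFC.sqrt_nonneg Q)
  have hBh : Bᴴ = B := hBps.isHermitian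
  have hBt : Bᵀ = B := by rw [← conjTranspose_eq_transpose_of_trivial, hBh]
  have hAt : Aᵀ = A := by rw [← conjTranspose_eq_transpose_of_trivial]; exact hA
  have hM : (B * A * B).IsHermitian := by
    have := isHermitian_conjTranspose_mul_mul B hA
    rwa [hBh] at this
  have hquad : ∀ x : EuclideanSpace ℝ ι,
      quad A (toEuclideanCLM (𝕜 := ℝ) B x) = x.ofLp ⬝ᵥ ((B * A * B) *ᵥ x.ofLp) := by
    intro x
    rw [quad, ofLp_toEuclideanCLM, ← mulVec_mulVec, ← mulVec_mulVec, dotProduct_mulVec _ B,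
      ← mulVec_transpose, hBt]
  set u := hM.eigenvectorBasis with hu
  -- Each weight is a value of the form `A` itself, so sign and size bounds on `quad A` pass to the
  -- weights.
  have hev : ∀ i, hM.eigenvalues i = quad A (toEuclideanCLM (𝕜 := ℝ) B (u i)) := by
    intro i
    rw [hquad, hM.eigenvalues_eq]
    simp [hu]
  refine ⟨hM.eigenvalues, ?_, ?_, ?_, ?_, ?_⟩
  · rw [← Fintype.card_subtype, ← hM.rank_eq_card_non_zero_eigs]
    calc (B * A * B).rank ≤ B.rank := rank_mul_le_right _ _
      _ = Q.rank := by rw [← hBB, ← rank_conjTranspose_mul_self B, hBh]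
  · have := hM.trace_eq_sum_eigenvalues
    simp only [RCLike.ofReal_real_eq_id, id_eq] at this
    rw [← this, frob, hAt, Matrix.mul_assoc, Matrix.trace_mul_comm, Matrix.mul_assoc, hBB]
  · intro h i
    rw [hev]
    exact h _
  · intro h
    -- The bound on `quad A` gives `|lᵢ| ≤ |B uᵢ|² = uᵢᵀ Q uᵢ`, and these sum to the trace in any
    -- orthonormal basis.
    have htr : Q.trace = ∑ i, (u i).ofLp ⬝ᵥ (Q *ᵥ (u i).ofLp) := by
      have := LinearMap.trace_eq_sum_inner (𝕜 := ℝ) (toEuclideanLin Q) u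
      rw [show (toEuclideanLin Q).trace ℝ _ = Q.trace by
        rw [toEuclideanLin, toLpLin_eq_toLin, Matrix.trace_toLin_eq]] at this
      rw [this]
      refine Finset.sum_congr rfl fun i _ => ?_
      rw [← inner_toEuclideanCLM]
      rfl
    rw [htr]
    refine Finset.sum_le_sum fun i _ => ?_
    rw [hev]
    refine (h _).trans (le_of_eq ?_)
    rw [ofLp_toEuclideanCLM, dotProduct_mulVec, ← mulVec_transpose, hBt, mulVec_mulVec, hBB,
      dotProduct_comm]
  · intro s hs
    -- By rotation invariance the standard Gaussian has independent coordinates in every orthonormal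
    -- basis, in particular in the eigenbasis `u`.
    have hlaw : multivariateGaussian 0 Q = (stdPi ι).map
        fun g => toEuclideanCLM (𝕜 := ℝ) B (∑ i, g i • u i) := by
      rw [multivariateGaussian, stdGaussian_eq_map_pi_orthonormalBasis u,
        Measure.map_map (by fun_prop) (by fun_prop)]
      congr 1
      ext g : 1
      simp [hB]
    rw [hlaw, map_measureReal_apply (by fun_prop) (show MeasurableSet {x | quad A x ∈ s} from
      measurable_quad A hs)]
    congr 1
    ext g
    show quad A (toEuclideanCLM (𝕜 := ℝ) B (∑ i, g i • u i)) ∈ s ↔ _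
    have hMu : ∀ i, toEuclideanCLM (𝕜 := ℝ) (B * A * B) (u i) = hM.eigenvalues i • u i := by
      intro i
      apply (WithLp.ofLp_injective 2)
      rw [ofLp_toEuclideanCLM]
      exact hM.mulVec_eigenvectorBasis i
    have : quad A (toEuclideanCLM (𝕜 := ℝ) B (∑ i, g i • u i))
        = ∑ i, hM.eigenvalues i * g i ^ 2 := by
      rw [hquad, ← inner_toEuclideanCLM, map_sum]
      simp_rw [map_smul, hMu, smul_smul]
      rw [u.orthonormal.inner_sum]
      refine Finset.sum_congr rfl fun i _ => ?_
      simp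
      ring
    rw [this]
    rfl

end Diagonalization
end PseudoBDML

/-! ### The constraint matrices: positivity, norm and trace. -/

namespace PseudoBDML

open MeasureTheory ProbabilityTheory Matrix
open scoped ENNReal NNReal MatrixOrder Kronecker

variable {N d q : ℕ}

theorem quad_nonneg {m : Type*} [Fintype m] {A : Matrix m m ℝ} (hA : A.PosSemidef)
    (x : EuclideanSpace ℝ m) : 0 ≤ quad A x := by
  simpa [quad] using hA.dotProduct_mulVec_nonneg x.ofLp

theorem posSemidef_liftedPair (x : Fin N → Fin d → ℝ) {lam : Fin q → ℝ} (hlam : ∀ u, 0 < lam u)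
    (p : Fin N × Fin N) : (liftedPair x lam p).PosSemidef := by
  refine PosSemidef.kronecker ?_ (PosSemidef.diagonal fun u => (hlam u).le)
  simpa [pairMatrix] using posSemidef_vecMulVec_self_star (x p.1 - x p.2)

theorem posSemidef_objMatrix (x : Fin N → Fin d → ℝ) {lam : Fin q → ℝ} (hlam : ∀ u, 0 < lam u)
    (S : Finset (Fin N × Fin N)) : (objMatrix x lam S).PosSemidef :=
  (posSemidef_sum S fun p _ => posSemidef_liftedPair x hlam p).smul (by positivity)

theorem isHermitian_orthMatrix (u v : Fin q) : (orthMatrix d u v).IsHermitian := by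
  ext ⟨k, a⟩ ⟨l, b⟩
  simp only [orthMatrix, conjTranspose_apply, kronecker_apply, one_apply, orthBlock, of_apply,
    star_trivial, eq_comm (a := l)]
  congr 2
  simp only [eq_iff_iff]
  tauto

/-- Viewing the block as a transposition cut down to the coordinates `u`, `v` treats `u = v` and `u
≠ v` uniformly and prepares the norm bound. -/
theorem orthBlock_mulVec (u v a : Fin q) (y : Fin q → ℝ) :
    (orthBlock u v *ᵥ y) a = if a = u ∨ a = v then y (Equiv.swap u v a) else 0 := by
  have h : ∀ b, orthBlock u v a b
      = if b = Equiv.swap u v a then (if a = u ∨ a = v then 1 else 0) else 0 := by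
    intro b
    simp only [orthBlock, of_apply, Equiv.swap_apply_def]
    grind
  simp only [mulVec, dotProduct, h]
  simp

/-- Apply `|a b| ≤ (a² + b²) / 2` to each product; the transposition only permutes the squares. -/
theorem abs_quad_orthMatrix_le (u v : Fin q) (x : EuclideanSpace ℝ (Fin d × Fin q)) :
    |quad (orthMatrix d u v) x| ≤ x.ofLp ⬝ᵥ x.ofLp := by
  have hmul : ∀ k a, (orthMatrix d u v *ᵥ x.ofLp) (k, a)
      = (orthBlock u v *ᵥ fun b => x.ofLp (k, b)) a := by
    intro k a
    simp [orthMatrix, mulVec, dotProduct, Fintype.sum_prod_type, one_apply]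
  have hswap : ∀ k, ∑ a, x.ofLp (k, Equiv.swap u v a) ^ 2 = ∑ a, x.ofLp (k, a) ^ 2 := fun k =>
    Equiv.sum_comp (Equiv.swap u v) fun a => x.ofLp (k, a) ^ 2
  simp only [quad, dotProduct, Fintype.sum_prod_type, hmul, orthBlock_mulVec]
  refine (Finset.abs_sum_le_sum_abs _ _).trans (Finset.sum_le_sum fun k _ => ?_)
  calc |∑ a, x.ofLp (k, a) * if a = u ∨ a = v then x.ofLp (k, Equiv.swap u v a) else 0|
      ≤ ∑ a, (x.ofLp (k, a) ^ 2 + x.ofLp (k, Equiv.swap u v a) ^ 2) / 2 := by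
        refine (Finset.abs_sum_le_sum_abs _ _).trans (Finset.sum_le_sum fun a _ => ?_)
        split_ifs
        · rw [abs_le]
          constructor <;>
            nlinarith [sq_nonneg (x.ofLp (k, a) - x.ofLp (k, Equiv.swap u v a)),
              sq_nonneg (x.ofLp (k, a) + x.ofLp (k, Equiv.swap u v a))]
        · rw [mul_zero, abs_zero]; positivity
    _ = ∑ a, x.ofLp (k, a) * x.ofLp (k, a) := by
        rw [← Finset.sum_div, Finset.sum_add_distrib, hswap, ← two_mul,
          mul_div_cancel_left₀ _ two_ne_zero]
        simp_rw [sq]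

theorem sum_orthMatrix_self : ∑ u : Fin q, orthMatrix d u u = 1 := by
  ext ⟨k, a⟩ ⟨l, b⟩
  by_cases hkl : k = l <;> by_cases hab : a = b <;>
    simp [Matrix.sum_apply, orthMatrix, orthBlock, one_apply, hkl, hab]
  exact fun h => hab h.symm

/-- The matrices `A_{uu}` sum to the identity, so the diagonal constraints add up to the trace. -/
theorem IsFeasible.trace_eq {x : Fin N → Fin d → ℝ} {lam : Fin q → ℝ} {μ : ℝ}
    {I : Finset (Fin N × Fin N)} {Q : Matrix (Fin d × Fin q) (Fin d × Fin q) ℝ}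
    (hQ : IsFeasible x lam μ I Q) : Q.trace = q := by
  have h1 : ∑ u : Fin q, frob (orthMatrix d u u) Q = Q.trace := by
    simp only [frob]
    rw [← trace_sum, ← Finset.sum_mul, ← transpose_sum, sum_orthMatrix_self, transpose_one,
      Matrix.one_mul]
  rw [← h1, Finset.sum_congr rfl fun u _ => hQ.orth (u, u) (by simp [orthIndex])]
  simp [orthRhs]

theorem card_orthIndex (q : ℕ) : ((orthIndex q).card : ℝ) = q * (q + 1) / 2 := by
  have h1 : (orthIndex q).card = ∑ b : Fin q, ((b : ℕ) + 1) := by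
    rw [orthIndex, Finset.card_filter, Fintype.sum_prod_type_right]
    refine Finset.sum_congr rfl fun b _ => ?_
    rw [← Finset.card_filter, Finset.filter_ge_eq_Iic, Fin.card_Iic]
  have h2 := Finset.sum_range_id_mul_two (q + 1)
  rw [Finset.sum_range_succ', add_zero, ← Fin.sum_univ_eq_sum_range fun b => b + 1, ← h1,
    Nat.add_sub_cancel] at h2
  have h3 : ((orthIndex q).card : ℝ) * 2 = (q + 1) * q := by exact_mod_cast h2
  linarith

/-! ### Tail bounds for quadratic forms in the Gaussian vector. -/

section Tails

variable {ι : Type*} [Fintype ι] [DecidableEq ι] {A Q : Matrix ι ι ℝ}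

/-- Small-ball estimate for a nonnegative quadratic form in a Gaussian vector. -/
theorem multivariateGaussian_quad_lt_le (hA : A.PosSemidef) (hQ : Q.PosSemidef) {μ γ : ℝ}
    (hμ : 0 < μ) (hγ : 0 < γ) (hAQ : μ ≤ frob A Q) :
    (multivariateGaussian 0 Q).real {x | quad A x < γ * μ}
      ≤ max √γ (2 * ((Q.rank : ℝ) - 1) * γ / (Real.pi - 2)) := by
  obtain ⟨l, hr, hsum, hl, -, hlaw⟩ := exists_diagonalization hA.isHermitian hQ
  refine (hlaw (Set.Iio (γ * μ)) measurableSet_Iio).trans_le (le_trans (measureReal_mono ?_)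
    (stdPi_sum_mul_sq_lt_le (hl (quad_nonneg hA)) hr (by rw [hsum]; linarith) hγ))
  intro g hg
  refine lt_of_lt_of_le (show _ < γ * μ from hg) ?_
  rw [hsum]
  gcongr

/-- Upper tail of a nonnegative quadratic form in a Gaussian vector. -/
theorem multivariateGaussian_lt_quad_le (hA : A.PosSemidef) (hQ : Q.PosSemidef) {ω : ℝ}
    (hω : 0 ≤ ω) :
    (multivariateGaussian 0 Q).real {x | ω * frob A Q < quad A x}
      ≤ Q.rank * Real.exp (-(ω / 2)) := by
  obtain ⟨l, hr, hsum, hl, -, hlaw⟩ := exists_diagonalization hA.isHermitian hQ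
  rw [← hsum]
  exact (hlaw (Set.Ioi (ω * ∑ i, l i)) measurableSet_Ioi).trans_le
    (stdPi_lt_sum_mul_sq_le (hl (quad_nonneg hA)) hr hω)

/-- Concentration of a quadratic form of operator norm at most one in a Gaussian vector. -/
theorem multivariateGaussian_lt_abs_quad_sub_le (hA : A.IsHermitian) (hQ : Q.PosSemidef)
    (hA1 : ∀ x : EuclideanSpace ℝ ι, |quad A x| ≤ x.ofLp ⬝ᵥ x.ofLp) {δ : ℝ} (hδ : 0 ≤ δ) :
    (multivariateGaussian 0 Q).real {x | Q.trace * δ < |quad A x - frob A Q|}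
      ≤ Q.rank * (Real.exp (-((1 + δ) / 2)) + Real.exp (-(δ ^ 2 / 4))) := by
  obtain ⟨l, hr, hsum, -, habs, hlaw⟩ := exists_diagonalization hA hQ
  rw [← hsum]
  refine (hlaw {y | Q.trace * δ < |y - ∑ i, l i|}
    (measurableSet_lt (by fun_prop) (by fun_prop))).trans_le (le_trans (measureReal_mono ?_)
    (stdPi_lt_abs_sum_mul_sq_sub_le hr hδ))
  intro g hg
  refine lt_of_le_of_lt ?_ (show Q.trace * δ < _ from hg)
  exact mul_le_mul_of_nonneg_right (habs hA1) hδ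

end Tails

/-- The concentration bound is applied at scale `δ = ε / (q √(2rd))`, where `qδ ≤ ε`, and then
weakened to the exponents in `τ` and `ε`. -/
theorem IsFeasible.multivariateGaussian_orth_le {x : Fin N → Fin d → ℝ} {lam : Fin q → ℝ} {μ : ℝ}
    {I : Finset (Fin N × Fin N)} {Q : Matrix (Fin d × Fin q) (Fin d × Fin q) ℝ}
    (hQ : IsFeasible x lam μ I Q) {p : Fin q × Fin q} (hp : p ∈ orthIndex q) {ε : ℝ} (hε : 0 ≤ ε) :
    (multivariateGaussian 0 Q).real {y | ε < |quad (orthMatrix d p.1 p.2) y - orthRhs p.1 p.2|}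
      ≤ Q.rank * (Real.exp (-((√(ε / q * √(2 / (Q.rank * d)) + 1) - 1) ^ 2 / 4))
        + Real.exp (-(ε ^ 2 / (8 * Q.rank * d * q ^ 2)))) := by
  have hq : 0 < q := p.1.pos
  have htr : Q.trace ≠ 0 := by rw [hQ.trace_eq]; exact_mod_cast hq.ne'
  have hd : 0 < d := by
    rcases Nat.eq_zero_or_pos d with h | h
    · subst h
      exact absurd (by simp [Matrix.trace]) htr
    · exact h
  -- Rank zero would make all weights vanish, against `A_{uu} • Q = 1`. With `d > 0` this gives `rd
  -- ≥ 1`, so that `√(2rd) ≥ 1`.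
  have hr : 0 < Q.rank := by
    refine Nat.pos_of_ne_zero fun h => ?_
    obtain ⟨l, hl, hsum, -⟩ :=
      exists_diagonalization (isHermitian_orthMatrix p.1 p.1) hQ.posSemidef
    rw [hQ.orth (p.1, p.1) (by simp [orthIndex])] at hsum
    rw [h, Nat.le_zero, Finset.card_eq_zero, Finset.filter_eq_empty_iff] at hl
    have hl0 : ∀ i, l i = 0 := fun i => not_not.1 (hl (Finset.mem_univ i))
    simp [hl0, orthRhs] at hsum
  set R : ℝ := (Q.rank : ℝ) * d with hR
  have hR1 : 1 ≤ R := by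
    have : 1 ≤ Q.rank * d := Nat.mul_pos hr hd
    rw [hR]
    exact_mod_cast this
  have hq0 : (0 : ℝ) < q := by exact_mod_cast hq
  have hs1 : 1 ≤ √(2 * R) := Real.one_le_sqrt.2 (by linarith)
  have hs2 : √(2 * R) ^ 2 = 2 * R := Real.sq_sqrt (by linarith)
  set s := √(2 * R) with hs
  have hs0 : 0 < s := by linarith
  -- With this `δ`, both `τ² = 1 + 2δ` and `ε² / (8rdq²) = δ² / 4` hold.
  set δ : ℝ := ε / (q * s) with hδ
  have hδ0 : 0 ≤ δ := by positivity
  have hsqrt : √(2 / R) = 2 / s := by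
    rw [Real.sqrt_eq_iff_mul_self_eq (by positivity) (by positivity)]
    field_simp
    nlinarith
  have hτ : ε / q * √(2 / R) + 1 = 1 + 2 * δ := by
    rw [hsqrt, hδ]
    field_simp
    ring
  have hτ1 : 1 ≤ √(1 + 2 * δ) := Real.one_le_sqrt.2 (by linarith)
  have hτ2 : √(1 + 2 * δ) ^ 2 = 1 + 2 * δ := Real.sq_sqrt (by linarith)
  have hδ2 : ε ^ 2 / (8 * Q.rank * d * q ^ 2) = δ ^ 2 / 4 := by
    rw [show (8 : ℝ) * Q.rank * d * q ^ 2 = 4 * (s ^ 2 * q ^ 2) by rw [hs2, hR]; ring, hδ]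
    field_simp
  have hb := multivariateGaussian_lt_abs_quad_sub_le (isHermitian_orthMatrix p.1 p.2)
    hQ.posSemidef (abs_quad_orthMatrix_le p.1 p.2) hδ0
  rw [hQ.orth p hp, hQ.trace_eq] at hb
  rw [hτ, hδ2]
  refine (measureReal_mono ?_).trans (hb.trans ?_)
  · intro y hy
    refine lt_of_le_of_lt ?_ (show ε < _ from hy)
    rw [hδ, ← mul_div_assoc, mul_div_mul_left _ _ hq0.ne']
    exact div_le_self hε hs1
  -- The left side equals `(1 + δ - τ) / 2`.
  · have : (√(1 + 2 * δ) - 1) ^ 2 / 4 ≤ (1 + δ) / 2 := by nlinarith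
    gcongr

end PseudoBDML

/-! ### Union bound over the failure events. -/

open PseudoBDML MeasureTheory ProbabilityTheory in
theorem theorem2 {N d q : ℕ}
    (x : Fin N → Fin d → ℝ) (S I : Finset (Fin N × Fin N))
    (lam : Fin q → ℝ) (hlam : ∀ u, 0 < lam u) (μ : ℝ) (hμ : 0 < μ)
    (Q : Matrix (Fin d × Fin q) (Fin d × Fin q) ℝ)
    (hQ : PseudoBDML.IsOptimal x lam μ S I Q)
    {Ω : Type*} [MeasurableSpace Ω] (P : MeasureTheory.Measure Ω)
    [MeasureTheory.IsProbabilityMeasure P]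
    (ξ : Ω → EuclideanSpace ℝ (Fin d × Fin q))
    (hξ : ProbabilityTheory.HasLaw ξ (ProbabilityTheory.multivariateGaussian 0 Q) P)
    (γ ε ω : ℝ) (hγ : 0 < γ) (hε : 0 ≤ ε) (hω : 1 ≤ ω)
    (r : ℕ) (hr : r = Q.rank)
    (τ : ℝ) (hτ : τ = Real.sqrt (ε / q * Real.sqrt (2 / (r * d)) + 1)) :
    1 - (I.card : ℝ) * max (Real.sqrt γ) (2 * ((r : ℝ) - 1) * γ / (Real.pi - 2))
        - r * Real.exp (-(1 / 2) * (ω - Real.sqrt (2 * ω - 1)))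
        - (r : ℝ) * q * (q + 1) / 2 *
          (Real.exp (-((τ - 1) ^ 2 / 4)) + Real.exp (-(ε ^ 2 / (8 * r * d * q ^ 2))))
      ≤ P.real {t | ((γ * μ : ℝ) : EReal) ≤ PseudoBDML.minMargin x lam I (ξ t)
          ∧ PseudoBDML.maxOrthError (ξ t) ≤ ((ε : ℝ) : EReal)
          ∧ PseudoBDML.quad (PseudoBDML.objMatrix x lam S) (ξ t)
            ≤ ω * PseudoBDML.frob (PseudoBDML.objMatrix x lam S) Q} := by
  subst hr hτ
  have hF := hQ.feasible
  set E : Set Ω := {t | ((γ * μ : ℝ) : EReal) ≤ minMargin x lam I (ξ t)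
    ∧ maxOrthError (ξ t) ≤ ((ε : ℝ) : EReal)
    ∧ quad (objMatrix x lam S) (ξ t) ≤ ω * frob (objMatrix x lam S) Q} with hE
  set F₁ : Fin N × Fin N → Set Ω := fun p => {t | quad (liftedPair x lam p) (ξ t) < γ * μ} with hF₁
  set F₂ : Set Ω := {t | ω * frob (objMatrix x lam S) Q < quad (objMatrix x lam S) (ξ t)} with hF₂
  set F₃ : Fin q × Fin q → Set Ω := fun p =>
    {t | ε < |quad (orthMatrix d p.1 p.2) (ξ t) - orthRhs p.1 p.2|} with hF₃
  have hb₁ : P.real (⋃ p ∈ I, F₁ p)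
      ≤ I.card * max √γ (2 * ((Q.rank : ℝ) - 1) * γ / (Real.pi - 2)) := by
    refine (measureReal_biUnion_finset_le _ _).trans
      ((Finset.sum_le_card_nsmul _ _ _ fun p hp => ?_).trans_eq (nsmul_eq_mul _ _))
    refine (hξ.measureReal_eq (p := fun y => quad (liftedPair x lam p) y < γ * μ)
      (measurableSet_lt (measurable_quad _) measurable_const)).trans_le ?_
    exact multivariateGaussian_quad_lt_le (posSemidef_liftedPair x hlam p) hF.posSemidef hμ hγ
      (hF.margin p hp)
  have hb₂ : P.real F₂ ≤ Q.rank * Real.exp (-(1 / 2) * (ω - √(2 * ω - 1))) := by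
    refine (hξ.measureReal_eq (p := fun y => ω * frob (objMatrix x lam S) Q
      < quad (objMatrix x lam S) y)
      (measurableSet_lt measurable_const (measurable_quad _))).trans_le ?_
    refine (multivariateGaussian_lt_quad_le (posSemidef_objMatrix x hlam S) hF.posSemidef
      (by linarith)).trans ?_
    -- Discarding `√(2ω - 1) ≥ 0` weakens `exp (-ω / 2)` to the stated term.
    gcongr
    linarith [Real.sqrt_nonneg (2 * ω - 1)]
  have hb₃ : P.real (⋃ p ∈ orthIndex q, F₃ p)
      ≤ (Q.rank : ℝ) * q * (q + 1) / 2 *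
        (Real.exp (-((√(ε / q * √(2 / (Q.rank * d)) + 1) - 1) ^ 2 / 4))
          + Real.exp (-(ε ^ 2 / (8 * Q.rank * d * q ^ 2)))) := by
    refine (measureReal_biUnion_finset_le _ _).trans
      ((Finset.sum_le_card_nsmul _ _
        (Q.rank * (Real.exp (-((√(ε / q * √(2 / (Q.rank * d)) + 1) - 1) ^ 2 / 4))
          + Real.exp (-(ε ^ 2 / (8 * Q.rank * d * q ^ 2))))) fun p hp => ?_).trans_eq ?_)
    · refine (hξ.measureReal_eq
        (p := fun y => ε < |quad (orthMatrix d p.1 p.2) y - orthRhs p.1 p.2|)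
        (measurableSet_lt measurable_const
          ((measurable_quad _).sub_const _).abs)).trans_le ?_
      exact hF.multivariateGaussian_orth_le hp hε
    · rw [nsmul_eq_mul, card_orthIndex]
      ring
  have hcover : (Set.univ : Set Ω) ⊆ E ∪ ((⋃ p ∈ I, F₁ p) ∪ (F₂ ∪ ⋃ p ∈ orthIndex q, F₃ p)) := by
    intro t _
    by_contra hcon
    simp only [Set.mem_union, Set.mem_iUnion, not_or, not_exists] at hcon
    obtain ⟨h, h₁, h₂, h₃⟩ := hcon
    -- In `EReal` an empty infimum is `⊤`, so an empty `I` needs no separate case.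
    refine h ⟨Finset.le_inf fun p hp => ?_, Finset.sup_le fun p hp => ?_, not_lt.1 h₂⟩
    · exact EReal.coe_le_coe_iff.2 (not_lt.1 (h₁ p hp))
    · exact EReal.coe_le_coe_iff.2 (not_lt.1 (h₃ p hp))
  have htotal : (1 : ℝ) ≤ P.real E
      + (P.real (⋃ p ∈ I, F₁ p) + (P.real F₂ + P.real (⋃ p ∈ orthIndex q, F₃ p))) := by
    have := measureReal_mono (μ := P) hcover
    rw [probReal_univ] at this
    exact this.trans ((measureReal_union_le _ _).trans (add_le_add_right
      ((measureReal_union_le _ _).trans (add_le_add_right (measureReal_union_le _ _) _)) _))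
  linarith
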